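/- Let $G$ be a countable group. A (left) Følner sequence in $G$ is a sequence $(F_n)$ of nonempty finite subsets of $G$ such that $|gF_n\triangle F_n|/|F_n|\to 0$ for every $g\in G$ (such a sequence exists exactly when $G$ is amenable). For $c>0$, the sequence is called $c$-bi-tempered if for all $n$ $$\Big|\bigcup_{i<n}F_i^{-1}F_n\Big|\le c\,|F_n|\quad\text{and}\quad \Big|\bigcup_{i<n}F_nF_i^{-1}\Big|\le c\,|F_n| .$$ For a measure-preserving action $(T_g)_{g\in G}$ of $G$ on a probability space $(X,\mathscr B,\mu)$ and a function $f:X\to\mathbb R$ put $\mathsf A_nf=\frac1{|F_n|}\sum_{g\in F_n}f\circ T_g$. For $\alpha<\beta$ and $N\ge 0$ let $D_N$ be the set of all $x\in X$ for which there are indices $n_1<n_2<\dots<n_{2N}$ with $\mathsf A_{n_i}f(x)\le\alpha$ for odd $i$ and $\mathsf A_{n_i}f(x)\ge\beta$ for even $i$. **Theorem.** For any real numbers $\alpha<\beta$ and $S>0$ there exist $\lambda>0$ and $0<c_0<1$ such that for every countable amenable group $G$, every $(1+\lambda)$-bi-tempered Følner sequence $(F_n)$ in $G$, every measure-preserving action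 of $G$ on a probability space $(X,\mathscr B,\mu)$ and every $f\in L^\infty_\mu(X)$ with $\|f\|_\infty\le S$, one has $$\mu(D_N)\le c_1c_0^N\qquad\text{for all } N\ge 0,$$ where $c_1>0$ is a constant which depends only on $G$ and the sequence $(F_n)$ (and not on $\alpha,\beta,S$, the action, the function $f$ or $N$). -/

import Mathlib

universe u v

open MeasureTheory Filter
open scoped Pointwise ENNReal

/-- A (left) Følner sequence in a discrete group: nonempty finite sets `F n` with
`|g F n ∆ F n| / |F n| → 0` for every `g`. A countable group is amenable if and only if it has
such a sequence. -/
def IsFolnerSequence {G : Type*} [Group G] (F : ℕ → Finset G) : Prop :=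
  (∀ n, (F n).Nonempty) ∧
    letI : MeasurableSpace G := ⊤
    IsFoelner G (Measure.count : Measure G) atTop (fun n => (F n : Set G))

open Classical in
/-- `|⋃_{i<n} (F i)⁻¹ (F n)| ≤ c |F n|` for all `n`. -/
def IsLeftTempered {G : Type*} [Group G] (c : ℝ) (F : ℕ → Finset G) : Prop :=
  ∀ n, (((Finset.range n).biUnion fun i => (F i)⁻¹ * F n).card : ℝ) ≤ c * (F n).card

open Classical in
/-- `|⋃_{i<n} (F n) (F i)⁻¹| ≤ c |F n|` for all `n`. -/
def IsRightTempered {G : Type*} [Group G] (c : ℝ) (F : ℕ → Finset G) : Prop :=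
  ∀ n, (((Finset.range n).biUnion fun i => F n * (F i)⁻¹).card : ℝ) ≤ c * (F n).card

/-- Left and right `c`-tempered. -/
def IsBiTempered {G : Type*} [Group G] (c : ℝ) (F : ℕ → Finset G) : Prop :=
  IsLeftTempered c F ∧ IsRightTempered c F

/-- The sequence `a` fluctuates (at least) `N` times across `(α, β)`: there are
`n₁ < n₂ < ⋯ < n₂ₙ` (`2N` indices) such that `a` is `≤ α` at the 1st, 3rd, … index and
`≥ β` at the 2nd, 4th, … index. The indices are numbered from `0` here, so odd and even
positions are interchanged. -/
def FluctuatesAcross (a : ℕ → ℝ) (α β : ℝ) (N : ℕ) : Prop :=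
  ∃ n : Fin (2 * N) → ℕ, StrictMono n ∧
    ∀ i, (Even i.val → a (n i) ≤ α) ∧ (Odd i.val → β ≤ a (n i))

/-- The average of `f` over `E x`: `|E|⁻¹ ∑_{g ∈ E} f (g x)`. -/
noncomputable def ergodicAverage {G X : Type*} [Group G] [MulAction G X]
    (E : Finset G) (f : X → ℝ) (x : X) : ℝ :=
  (∑ g ∈ E, f (g • x)) / E.card

/-- The points whose ergodic averages along `F` fluctuate at least `N` times across `(α, β)`. -/
def fluctuationSet {G X : Type*} [Group G] [MulAction G X]
    (F : ℕ → Finset G) (f : X → ℝ) (α β : ℝ) (N : ℕ) : Set X :=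
  {x | FluctuatesAcross (fun n => ergodicAverage (F n) f x) α β N}

/-!
The proof transfers the problem to the group. There, a set of points with many fluctuations starts a
long chain of sets, each larger than the one before it by a fixed factor, and the last of them is
hardly larger than the Følner set in which everything takes place.

Fix a point `x` and put `φ g = f (g • x)`, so that the `n`-th average at `g • x` is the mean of `φ`
over the right translate `F n * g`. Let `D` be a finite set of `g` for which these means fluctuate
`N` times, with scales `ν g 0 < ν g 1 < ⋯`. Cut the positions into blocks of length `2 * k`.

* Covering. Suppose that every point of a finite set `W` lies in a translate `F i * g` with `g ∈ D`
  and `i` below a block of scales of `g`. Go through all translates `F n * g` with `n` in that block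
  and of one parity, larger `n` first, and choose those that meet the union of the sets chosen so
  far in less than an `ε`-fraction. Then the union `E` of the chosen sets covers `W` up to
  `2 * ε * |E|` points (`exists_almostDisjoint_cover`). Temperedness on the right makes `F n * g`
  nearly independent of the `g` to which a point of `W` is attached. Temperedness on the left shows
  that few points can be near a large chosen set without belonging to it. Any other uncovered point
  has, at each of its `k` scales `n`, an `ε / 2`-fraction of its translate inside the part of `E`
  whose largest chosen set has scale exactly `n`. These parts are disjoint, so a double count bounds
  the number of such points by `2 * |E| / (ε * k)`.
* Growth. As the chosen sets are almost disjoint, `φ` has mean almost `≥ β` on `E` for a block with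
  odd positions, and almost `≤ α` for a block with even positions. If `E₁` is nearly contained in
  `E₂` and the two means differ by almost `β - α`, while `φ` is bounded, then
  `|E₁| ≤ (1 - 8 * ε) * |E₂|` (`card_le_mul_card_of_opposite_sums`). Alternating the two parities
  gives `|D| ≤ 2 * (1 - 8 * ε) ^ s * |E|` after `s + 1` blocks (`card_le_of_fluctuations`).
* Transference. If the indices are at most `R` and `D ⊆ F m`, then `E` lies in the product of
  `⋃ i ≤ R, F i` with `F m`, which has at most `2 * |F m|` elements for a suitable `m` by the Følner
  property. Integrating over `x` yields the bound for the measure, with `c₁ = 16` for every group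
  and sequence.
-/

/-! ### Almost disjoint subfamilies -/

/-- Greedy selection by decreasing rank: a set is chosen if it meets the union of the sets chosen so
far in less than an `ε`-fraction of itself. Afterwards every set has an `ε`-fraction covered by
chosen sets of at least its own rank. The chosen sets are almost disjoint, so nonnegativity of the
sum of `ψ` over each set passes to their union up to a small error. -/
theorem exists_almostDisjoint_subfamily {ι γ : Type*} [DecidableEq ι] [DecidableEq γ]
    (T : Finset ι) (A : ι → Finset γ) (rank : ι → ℕ) (ψ : γ → ℝ) {ε C : ℝ}
    (hε1 : ε ≤ 1) (hC : 0 ≤ C) (hψ : ∀ x, ψ x ≤ C)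
    (hA : ∀ t ∈ T, 0 ≤ ∑ x ∈ A t, ψ x) :
    ∃ K ⊆ T,
      (∀ t ∈ T, ε * (A t).card ≤ (A t ∩ {c ∈ K | rank t ≤ rank c}.biUnion A).card) ∧
      (1 - ε) * ∑ c ∈ K, ((A c).card : ℝ) ≤ (K.biUnion A).card ∧
      -(C * ε * ∑ c ∈ K, ((A c).card : ℝ)) ≤ ∑ x ∈ K.biUnion A, ψ x := by
  induction T using Finset.induction_on_min_value rank with
  | empty => exact ⟨∅, by simp⟩
  | insert t T htT hmin ih =>
    obtain ⟨K, hKT, hcov, hcard, hsum⟩ := ih fun s hs => hA s (Finset.mem_insert_of_mem hs)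
    have hfil : {c ∈ K | rank t ≤ rank c} = K :=
      Finset.filter_true_of_mem fun c hc => hmin c (hKT hc)
    by_cases hbig : ε * (A t).card ≤ (A t ∩ K.biUnion A).card
    · refine ⟨K, hKT.trans (Finset.subset_insert _ _), fun s hs => ?_, hcard, hsum⟩
      rcases Finset.mem_insert.1 hs with rfl | hs
      · rwa [hfil]
      · exact hcov s hs
    · have htK : t ∉ K := fun h => htT (hKT h)
      refine ⟨insert t K, Finset.insert_subset_insert _ hKT, fun s hs => ?_, ?_, ?_⟩
      · rcases Finset.mem_insert.1 hs with rfl | hs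
        · have : A s ∩ {c ∈ insert s K | rank s ≤ rank c}.biUnion A = A s := by
            refine Finset.inter_eq_left.2 (Finset.subset_biUnion_of_mem A ?_)
            simp
          rw [this]
          exact mul_le_of_le_one_left (by positivity) hε1
        · refine (hcov s hs).trans ?_
          gcongr
          exact Finset.subset_insert _ _
      · rw [Finset.sum_insert htK, Finset.biUnion_insert, ← Finset.sdiff_union_self_eq_union,
          Finset.card_union_of_disjoint Finset.sdiff_disjoint]
        have h := Finset.card_sdiff_add_card_inter (A t) (K.biUnion A)
        have h' : ((A t \ K.biUnion A).card : ℝ) + (A t ∩ K.biUnion A).card = (A t).card := by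
          exact_mod_cast h
        push_cast
        nlinarith
      · rw [Finset.sum_insert htK, Finset.biUnion_insert, ← Finset.sdiff_union_self_eq_union,
          Finset.sum_union Finset.sdiff_disjoint]
        have h := Finset.sum_sdiff_eq_sub (f := ψ)
          (Finset.inter_subset_left (s₁ := A t) (s₂ := K.biUnion A))
        rw [Finset.sdiff_inter_self_left] at h
        have h2 : ∑ x ∈ A t ∩ K.biUnion A, ψ x ≤ C * (A t ∩ K.biUnion A).card := by
          refine (Finset.sum_le_card_nsmul _ _ C fun x _ => hψ x).trans ?_
          rw [nsmul_eq_mul, mul_comm]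
        have h3 := hA t (Finset.mem_insert_self _ _)
        have h4 : C * (A t ∩ K.biUnion A).card ≤ C * (ε * (A t).card) := by
          gcongr
          exact (not_le.1 hbig).le
        linarith

section

variable {G : Type*} [Group G]

/-! ### Tempered sequences -/

/-- The right translate `s * g`, as the image of `s` under an embedding, so that no decidable
equality is involved. -/
def rightTranslate (s : Finset G) (g : G) : Finset G := s.map (mulRightEmbedding g)

theorem mem_rightTranslate {s : Finset G} {g x : G} :
    x ∈ rightTranslate s g ↔ ∃ y ∈ s, y * g = x := by
  simp [rightTranslate]

theorem card_rightTranslate (s : Finset G) (g : G) : (rightTranslate s g).card = s.card := by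
  simp [rightTranslate]

theorem sum_rightTranslate (s : Finset G) (g : G) (ψ : G → ℝ) :
    ∑ x ∈ rightTranslate s g, ψ x = ∑ y ∈ s, ψ (y * g) := by
  simp [rightTranslate]

open Classical in
/-- If `h ∈ F i * g` with `i < n`, then `F n * g` and `F n * a⁻¹ * h` both lie in the translate by
`h` of the set `⋃_{i<n} F n * (F i)⁻¹`, which is hardly larger than `F n`. The element `a ∈ F 0`
replaces the identity, which need not belong to any `F i`. -/
theorem card_rightTranslate_inter_le {F : ℕ → Finset G} {lam : ℝ}
    (hF : IsRightTempered (1 + lam) F) {a g h : G} (ha : a ∈ F 0) {i n : ℕ} (hin : i < n)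
    (hh : h ∈ rightTranslate (F i) g) (X : Finset G) :
    ((rightTranslate (F n) g ∩ X).card : ℝ) ≤
      (rightTranslate (F n) (a⁻¹ * h) ∩ X).card + lam * (F n).card := by
  have hU := hF n
  set U := (Finset.range n).biUnion fun i => F n * (F i)⁻¹ with hUdef
  obtain ⟨y, hy, rfl⟩ := mem_rightTranslate.1 hh
  have h1 : rightTranslate (F n) g ⊆ rightTranslate U (y * g) := by
    intro x hx
    obtain ⟨z, hz, rfl⟩ := mem_rightTranslate.1 hx
    refine mem_rightTranslate.2 ⟨z * y⁻¹, ?_, by group⟩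
    exact Finset.mem_biUnion.2 ⟨i, Finset.mem_range.2 hin,
      Finset.mul_mem_mul hz (Finset.inv_mem_inv hy)⟩
  have h2 : rightTranslate (F n) (a⁻¹ * (y * g)) ⊆ rightTranslate U (y * g) := by
    intro x hx
    obtain ⟨z, hz, rfl⟩ := mem_rightTranslate.1 hx
    refine mem_rightTranslate.2 ⟨z * a⁻¹, ?_, by group⟩
    exact Finset.mem_biUnion.2 ⟨0, Finset.mem_range.2 (by omega),
      Finset.mul_mem_mul hz (Finset.inv_mem_inv ha)⟩
  set V := rightTranslate U (y * g)
  set P := rightTranslate (F n) g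
  set Q := rightTranslate (F n) (a⁻¹ * (y * g))
  have h3 : P ∩ X ⊆ (Q ∩ X) ∪ (V \ Q) := by
    intro x hx
    rw [Finset.mem_inter] at hx
    by_cases hq : x ∈ Q
    · exact Finset.mem_union_left _ (Finset.mem_inter.2 ⟨hq, hx.2⟩)
    · exact Finset.mem_union_right _ (Finset.mem_sdiff.2 ⟨h1 hx.1, hq⟩)
  have h4 := (Finset.card_le_card h3).trans (Finset.card_union_le _ _)
  have h5 := Finset.card_sdiff_add_card_eq_card h2
  have hV : V.card = U.card := card_rightTranslate _ _
  have hQ : Q.card = (F n).card := card_rightTranslate _ _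
  have h4' : ((P ∩ X).card : ℝ) ≤ (Q ∩ X).card + (V \ Q).card := by exact_mod_cast h4
  have h5' : ((V \ Q).card : ℝ) + (F n).card = U.card := by
    rw [← hQ, ← hV]; exact_mod_cast h5
  linarith

open Classical in
/-- The thickening `⋃_{i<n} (F i)⁻¹ * F n * g` of `F n * g`, shifted by an `a ∈ F 0`, has few points
outside `F n * g`. -/
theorem card_smul_rightTranslate_sdiff_le {F : ℕ → Finset G} {lam : ℝ} (hlam : 0 ≤ lam)
    (hF : IsLeftTempered (1 + lam) F) {a : G} (ha : a ∈ F 0) (n : ℕ) (g : G) :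
    ((a • rightTranslate ((Finset.range n).biUnion fun i => (F i)⁻¹ * F n) g \
      rightTranslate (F n) g).card : ℝ) ≤ lam * (F n).card := by
  rcases Nat.eq_zero_or_pos n with rfl | hn
  · have : (0 : ℝ) ≤ lam * (F 0).card := by positivity
    simpa [rightTranslate] using this
  have hL := hF n
  set L := (Finset.range n).biUnion fun i => (F i)⁻¹ * F n
  have hsub : rightTranslate (F n) g ⊆ a • rightTranslate L g := by
    intro x hx
    obtain ⟨z, hz, rfl⟩ := mem_rightTranslate.1 hx
    refine Finset.mem_smul_finset.2 ⟨a⁻¹ * z * g, mem_rightTranslate.2 ⟨a⁻¹ * z, ?_, rfl⟩, ?_⟩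
    · exact Finset.mem_biUnion.2 ⟨0, Finset.mem_range.2 hn,
        Finset.mul_mem_mul (Finset.inv_mem_inv ha) hz⟩
    · simp [mul_assoc]
  have h := Finset.card_sdiff_add_card_eq_card hsub
  rw [Finset.card_smul_finset, card_rightTranslate, card_rightTranslate] at h
  have h' : ((a • rightTranslate L g \ rightTranslate (F n) g).card : ℝ) + (F n).card =
      L.card := by exact_mod_cast h
  linarith

open Classical in
/-- Double counting. The layers `{x ∈ E | ρ x = n}` are disjoint, and a point `x` of layer `n` lies
in `F n * a⁻¹ * h` for at most `|F n|` elements `h`. Hence few `h` can have, at `k` different scales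
`n`, a fixed proportion of `F n * a⁻¹ * h` inside layer `n`. -/
theorem card_mul_le_card_of_translates_meet_layers {F : ℕ → Finset G} (hne : ∀ n, (F n).Nonempty)
    (B E : Finset G) (N : G → Finset ℕ) (ρ : G → ℕ) (a : G) {k : ℕ} {δ : ℝ}
    (hN : ∀ h ∈ B, (N h).card = k)
    (hB : ∀ h ∈ B, ∀ n ∈ N h,
      δ * (F n).card ≤ {x ∈ E | ρ x = n ∧ x ∈ rightTranslate (F n) (a⁻¹ * h)}.card) :
    k * δ * B.card ≤ E.card := by
  have hpos : ∀ n, (0 : ℝ) < (F n).card := fun n => by exact_mod_cast (hne n).card_pos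
  have h1 : ∀ h ∈ B, k * δ ≤
      ∑ x ∈ E, if x ∈ rightTranslate (F (ρ x)) (a⁻¹ * h) then ((F (ρ x)).card : ℝ)⁻¹ else 0 := by
    intro h hh
    calc (k : ℝ) * δ = ∑ n ∈ N h, δ := by rw [Finset.sum_const, hN h hh, nsmul_eq_mul]
      _ ≤ ∑ n ∈ N h, ∑ x ∈ E,
          if ρ x = n then (if x ∈ rightTranslate (F (ρ x)) (a⁻¹ * h)
            then ((F (ρ x)).card : ℝ)⁻¹ else 0) else 0 := by
        refine Finset.sum_le_sum fun n hn => ?_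
        have h2 := hB h hh n hn
        rw [← le_div_iff₀ (hpos n)] at h2
        refine h2.trans_eq ?_
        rw [Finset.card_filter, Nat.cast_sum, Finset.sum_div]
        refine Finset.sum_congr rfl fun x _ => ?_
        by_cases hx : ρ x = n
        · subst hx
          by_cases hx' : x ∈ rightTranslate (F (ρ x)) (a⁻¹ * h) <;> simp [hx']
        · simp [hx]
      _ = ∑ x ∈ E, ∑ n ∈ N h,
          if ρ x = n then (if x ∈ rightTranslate (F (ρ x)) (a⁻¹ * h)
            then ((F (ρ x)).card : ℝ)⁻¹ else 0) else 0 := Finset.sum_comm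
      _ ≤ _ := by
        refine Finset.sum_le_sum fun x _ => ?_
        rw [Finset.sum_ite_eq]
        split_ifs <;> first | exact le_rfl | positivity
  calc (k : ℝ) * δ * B.card = ∑ h ∈ B, k * δ := by
        rw [Finset.sum_const, nsmul_eq_mul, mul_comm]
    _ ≤ _ := Finset.sum_le_sum h1
    _ = ∑ x ∈ E, ∑ h ∈ B,
        if x ∈ rightTranslate (F (ρ x)) (a⁻¹ * h) then ((F (ρ x)).card : ℝ)⁻¹ else 0 :=
      Finset.sum_comm
    _ ≤ ∑ x ∈ E, (1 : ℝ) := by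
        refine Finset.sum_le_sum fun x _ => ?_
        rw [← Finset.sum_filter, Finset.sum_const, nsmul_eq_mul, ← div_eq_mul_inv,
          div_le_one (hpos _), Nat.cast_le]
        refine Finset.card_le_card_of_injOn (fun h => x * h⁻¹ * a) ?_ ?_
        · intro h hh
          obtain ⟨y, hy, hyx⟩ := mem_rightTranslate.1 (Finset.mem_filter.1 hh).2
          have : x * h⁻¹ * a = y := by rw [← hyx]; group
          simpa [this] using hy
        · intro h _ h' _ hhh
          simpa using hhh
    _ = E.card := by simp

/-- Numerical end of the covering lemma: `b₁` counts the uncovered points away from the thickened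
chosen sets, `b₂` bounds those in the thickening, `M` is the total size of the chosen sets and `e`
the size of their union. -/
theorem sdiff_bound {ε lam k M e b₁ b₂ w : ℝ} (hε0 : 0 < ε) (hlam : lam ≤ ε / 2)
    (hk : 2 / ε ^ 2 ≤ k) (hM : M ≤ 2 * e) (hb₁ : 0 ≤ b₁)
    (h₁ : k * (ε - lam) * b₁ ≤ e) (h₂ : b₂ ≤ lam * M) (hw : w ≤ b₁ + b₂) (hM0 : 0 ≤ M) :
    w ≤ 2 * ε * e := by
  have hk0 : 0 ≤ k := le_trans (by positivity) hk
  have h3 : 1 ≤ ε * (k * (ε - lam)) := by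
    rw [div_le_iff₀ (by positivity)] at hk
    nlinarith [mul_nonneg (mul_nonneg hε0.le hk0) (sub_nonneg.2 hlam)]
  have h4 : b₁ ≤ ε * e := by
    calc b₁ ≤ ε * (k * (ε - lam)) * b₁ := le_mul_of_one_le_left hb₁ h3
      _ = ε * (k * (ε - lam) * b₁) := by ring
      _ ≤ ε * e := by gcongr
  have h5 : lam * M ≤ ε / 2 * (2 * e) :=
    (mul_le_mul_of_nonneg_right hlam hM0).trans (mul_le_mul_of_nonneg_left hM (by positivity))
  linarith

open Classical in
/-- The covering lemma. If `k` scales are available at each point of `W`, then almost disjoint sets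
among the `F n * g h` cover most of `W`, and the sum of `ψ` over their union is almost nonnegative.
One scale would not do: it guarantees only that a fixed small proportion is covered. -/
theorem exists_almostDisjoint_cover {F : ℕ → Finset G} (hne : ∀ n, (F n).Nonempty)
    {lam ε C : ℝ} (hε0 : 0 < ε) (hε : ε ≤ 1 / 2) (hlam0 : 0 ≤ lam) (hlam : lam ≤ ε / 2)
    (hF : IsBiTempered (1 + lam) F) {k : ℕ} (hk : 2 / ε ^ 2 ≤ k) (hC : 0 ≤ C) {ψ : G → ℝ}
    (hψ : ∀ x, ψ x ≤ C) (W : Finset G) (g : G → G) (N : G → Finset ℕ)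
    (hN : ∀ h ∈ W, (N h).card = k)
    (hW : ∀ h ∈ W, ∃ i, h ∈ rightTranslate (F i) (g h) ∧ ∀ n ∈ N h, i < n)
    (hsum : ∀ h ∈ W, ∀ n ∈ N h, 0 ≤ ∑ y ∈ F n, ψ (y * g h)) :
    ∃ E : Finset G, (∀ x ∈ E, ∃ h ∈ W, ∃ n ∈ N h, x ∈ rightTranslate (F n) (g h)) ∧
      ((W \ E).card : ℝ) ≤ 2 * ε * E.card ∧ -(2 * C * ε * E.card) ≤ ∑ x ∈ E, ψ x := by
  obtain ⟨a, ha⟩ := hne 0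
  set A : (Σ _ : G, ℕ) → Finset G := fun t => rightTranslate (F t.2) (g t.1) with hA
  have hcardA : ∀ t, (A t).card = (F t.2).card := fun t => card_rightTranslate _ _
  obtain ⟨K, hKT, hcov, hcard, hsumE⟩ := exists_almostDisjoint_subfamily (W.sigma N) A
    (fun t => t.2) ψ (hε.trans (by norm_num)) hC hψ (by
      intro t ht
      rw [Finset.mem_sigma] at ht
      simp only [hA, sum_rightTranslate]
      exact hsum _ ht.1 _ ht.2)
  set E := K.biUnion A with hE
  set M : ℝ := ∑ c ∈ K, ((A c).card : ℝ) with hM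
  have hM0 : 0 ≤ M := Finset.sum_nonneg fun _ _ => by positivity
  have hM2 : M ≤ 2 * E.card := by nlinarith
  set L : ℕ → Finset G := fun n => (Finset.range n).biUnion fun i => (F i)⁻¹ * F n with hL
  -- `B₁` stays away from all thickened chosen sets; `B₂` is what the thickening adds to `E`.
  set B₁ := {h ∈ W | ∀ t ∈ K, a⁻¹ * h ∉ rightTranslate (L t.2) (g t.1)} with hB₁
  set B₂ := K.biUnion fun t => a • rightTranslate (L t.2) (g t.1) \ A t with hB₂
  have hsub : W \ E ⊆ B₁ ∪ B₂ := by
    intro h hh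
    rw [Finset.mem_sdiff] at hh
    by_cases hb : h ∈ B₁
    · exact Finset.mem_union_left _ hb
    · have : ∃ t ∈ K, a⁻¹ * h ∈ rightTranslate (L t.2) (g t.1) := by
        by_contra! hcon
        exact hb (Finset.mem_filter.2 ⟨hh.1, hcon⟩)
      obtain ⟨t, ht, hht⟩ := this
      refine Finset.mem_union_right _ (Finset.mem_biUnion.2 ⟨t, ht, Finset.mem_sdiff.2 ⟨?_, ?_⟩⟩)
      · exact Finset.mem_smul_finset.2 ⟨_, hht, by simp⟩
      · exact fun hc => hh.2 (Finset.mem_biUnion.2 ⟨t, ht, hc⟩)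
  have hB₂card : (B₂.card : ℝ) ≤ lam * M := by
    have h1 : (B₂.card : ℝ) ≤
        ∑ t ∈ K, ((a • rightTranslate (L t.2) (g t.1) \ A t).card : ℝ) := by
      exact_mod_cast Finset.card_biUnion_le
    refine h1.trans ?_
    rw [hM, Finset.mul_sum]
    refine Finset.sum_le_sum fun t _ => ?_
    rw [hcardA]
    exact card_smul_rightTranslate_sdiff_le hlam0 hF.1 ha _ _
  -- The layer of a point of `E` is the largest scale of a chosen set containing it.
  set ρ : G → ℕ := fun x => {c ∈ K | x ∈ A c}.sup (fun t => t.2) with hρ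
  have hlayer : ∀ h ∈ B₁, ∀ n ∈ N h, (ε - lam) * (F n).card ≤
      {x ∈ E | ρ x = n ∧ x ∈ rightTranslate (F n) (a⁻¹ * h)}.card := by
    intro h hh n hn
    rw [hB₁, Finset.mem_filter] at hh
    obtain ⟨i, hi, hin⟩ := hW h hh.1
    have h1 := hcov ⟨h, n⟩ (Finset.mem_sigma.2 ⟨hh.1, hn⟩)
    rw [hcardA] at h1
    -- Passing to the translate at `a⁻¹ * h` costs a proportion `lam` and no longer involves `g h`.
    have h2 := card_rightTranslate_inter_le hF.2 ha (hin n hn) hi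
      ({c ∈ K | n ≤ c.2}.biUnion A)
    have h3 : rightTranslate (F n) (a⁻¹ * h) ∩ {c ∈ K | n ≤ c.2}.biUnion A ⊆
        {x ∈ E | ρ x = n ∧ x ∈ rightTranslate (F n) (a⁻¹ * h)} := by
      intro x hx
      rw [Finset.mem_inter, Finset.mem_biUnion] at hx
      obtain ⟨hx, c, hc, hxc⟩ := hx
      rw [Finset.mem_filter] at hc
      refine Finset.mem_filter.2 ⟨Finset.mem_biUnion.2 ⟨c, hc.1, hxc⟩, ?_, hx⟩
      refine le_antisymm (not_lt.1 fun hlt => ?_) (hc.2.trans ?_)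
      -- A chosen set of larger scale through `x` would put `a⁻¹ * h` in its left thickening.
      · obtain ⟨t, ht, hnt⟩ := Finset.lt_sup_iff.1 hlt
        rw [Finset.mem_filter] at ht
        obtain ⟨z, hz, hzx⟩ := mem_rightTranslate.1 hx
        obtain ⟨z', hz', hzx'⟩ := mem_rightTranslate.1 ht.2
        refine hh.2 t ht.1 (mem_rightTranslate.2 ⟨z⁻¹ * z', ?_, ?_⟩)
        · exact Finset.mem_biUnion.2 ⟨n, Finset.mem_range.2 hnt,
            Finset.mul_mem_mul (Finset.inv_mem_inv hz) hz'⟩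
        · rw [mul_assoc, hzx', ← hzx]; group
      · exact Finset.le_sup (f := fun t : (Σ _ : G, ℕ) => t.2)
          (Finset.mem_filter.2 ⟨hc.1, hxc⟩)
    have h4 : ((rightTranslate (F n) (a⁻¹ * h) ∩ {c ∈ K | n ≤ c.2}.biUnion A).card : ℝ) ≤
        {x ∈ E | ρ x = n ∧ x ∈ rightTranslate (F n) (a⁻¹ * h)}.card := by
      exact_mod_cast Finset.card_le_card h3
    simp only [hA] at h1 h2 h4
    linarith
  have hB₁card := card_mul_le_card_of_translates_meet_layers hne B₁ E N ρ a
    (fun h hh => hN h (Finset.mem_filter.1 hh).1) hlayer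
  refine ⟨E, ?_, ?_, ?_⟩
  · intro x hx
    obtain ⟨t, ht, hxt⟩ := Finset.mem_biUnion.1 hx
    have := Finset.mem_sigma.1 (hKT ht)
    exact ⟨t.1, this.1, t.2, this.2, hxt⟩
  · have h1 : ((W \ E).card : ℝ) ≤ B₁.card + B₂.card := by
      exact_mod_cast (Finset.card_le_card hsub).trans (Finset.card_union_le _ _)
    exact sdiff_bound hε0 hlam hk hM2 (Nat.cast_nonneg _) hB₁card hB₂card h1 hM0
  · have h1 : C * ε * M ≤ C * ε * (2 * E.card) :=
      mul_le_mul_of_nonneg_left hM2 (mul_nonneg hC hε0.le)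
    linarith only [h1, hsumE]

end

/-! ### Growth along alternating covers -/

open Classical in
/-- If `ψ` has mean almost `≥ 0` on `E₁` and almost `≤ -16 * ε * C` on `E₂`, and `E₁` is nearly
contained in `E₂`, then `E₂` is larger by a definite factor: the points of `E₂` outside `E₁` have
to lower the mean, and `|ψ| ≤ C`. -/
theorem card_le_mul_card_of_opposite_sums {γ : Type*} {E₁ E₂ : Finset γ} {ψ : γ → ℝ}
    {C ε : ℝ} (hC : 0 < C) (hε : 0 ≤ ε) (hε1 : ε ≤ 1 / 16) (hψ : ∀ x, |ψ x| ≤ C)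
    (h₁ : -(2 * C * ε * E₁.card) ≤ ∑ x ∈ E₁, ψ x)
    (h₂ : -(2 * C * ε * E₂.card) ≤ ∑ x ∈ E₂, (-(16 * ε * C) - ψ x))
    (h : ((E₁ \ E₂).card : ℝ) ≤ 2 * ε * E₂.card) :
    (E₁.card : ℝ) ≤ (1 - 8 * ε) * E₂.card := by
  have hb : ∀ s : Finset γ, |∑ x ∈ s, ψ x| ≤ C * s.card := fun s => by
    refine (Finset.abs_sum_le_sum_abs _ _).trans ((Finset.sum_le_card_nsmul _ _ C
      fun x _ => hψ x).trans ?_)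
    rw [nsmul_eq_mul, mul_comm]
  have e1 := Finset.card_sdiff_add_card_inter E₁ E₂
  have e2 := Finset.card_sdiff_add_card_inter E₂ E₁
  rw [Finset.inter_comm] at e2
  have e1' : ((E₁ \ E₂).card : ℝ) + (E₁ ∩ E₂).card = E₁.card := by exact_mod_cast e1
  have e2' : ((E₂ \ E₁).card : ℝ) + (E₁ ∩ E₂).card = E₂.card := by exact_mod_cast e2
  have s1 := Finset.sum_inter_add_sum_sdiff E₁ E₂ ψ
  have s2 := Finset.sum_inter_add_sum_sdiff E₂ E₁ ψ
  rw [Finset.inter_comm] at s2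
  have b1 := (abs_le.1 (hb (E₁ \ E₂))).2
  have b2 := (abs_le.1 (hb (E₂ \ E₁))).1
  rw [Finset.sum_sub_distrib, Finset.sum_const, nsmul_eq_mul] at h₂
  have hCh := mul_le_mul_of_nonneg_left h hC.le
  have key : C * ((1 - 2 * ε) * E₁.card) ≤ C * ((1 - 10 * ε) * E₂.card) := by
    have e3 : ((E₂ \ E₁).card : ℝ) = E₂.card - E₁.card + (E₁ \ E₂).card := by linarith
    rw [e3] at b2
    linarith
  have key2 := le_of_mul_le_mul_left key hC
  have h3 : (1 - 2 * ε) * (E₁.card : ℝ) ≤ (1 - 2 * ε) * ((1 - 8 * ε) * E₂.card) := by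
    refine key2.trans ?_
    nlinarith [mul_nonneg (mul_nonneg hε hε) (Nat.cast_nonneg (α := ℝ) E₂.card)]
  exact le_of_mul_le_mul_left h3 (by linarith)

section

variable {G : Type*} [Group G]

open Classical in
/-- The iterated covering. A set `E` whose points lie in translates of scale at most that of
position `2 * k * (s + 1)` serves as the set to be covered in the next block. That block uses
strictly later positions, of the opposite parity. -/
theorem card_le_of_fluctuations {F : ℕ → Finset G} (hne : ∀ n, (F n).Nonempty)
    {lam ε C α β : ℝ} (hε0 : 0 < ε) (hε : ε ≤ 1 / 16) (hlam0 : 0 ≤ lam) (hlam : lam ≤ ε / 2)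
    (hF : IsBiTempered (1 + lam) F) {k : ℕ} (hk : 2 / ε ^ 2 ≤ k) (hC : 0 < C)
    (hgap : β - α = 16 * ε * C) {φ : G → ℝ} (hα : ∀ x, |α - φ x| ≤ C) (hβ : ∀ x, |φ x - β| ≤ C)
    {D : Finset G} {N : ℕ} {ν : G → ℕ → ℕ}
    (hmono : ∀ g ∈ D, ∀ i j, i < j → j < 2 * N → ν g i < ν g j)
    (heven : ∀ g ∈ D, ∀ j < 2 * N, Even j → (∑ y ∈ F (ν g j), φ (y * g)) / (F (ν g j)).card ≤ α)
    (hodd : ∀ g ∈ D, ∀ j < 2 * N, Odd j → β ≤ (∑ y ∈ F (ν g j), φ (y * g)) / (F (ν g j)).card)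
    (s : ℕ) (hs : k * (s + 1) < N) :
    ∃ E : Finset G, (∀ x ∈ E, ∃ g ∈ D, ∃ i ≤ ν g (2 * k * (s + 1)), x ∈ rightTranslate (F i) g) ∧
      (D.card : ℝ) ≤ 2 * (1 - 8 * ε) ^ s * E.card ∧
      -(2 * C * ε * E.card) ≤ ∑ x ∈ E, if Even s then φ x - β else α - φ x := by
  have hpos : ∀ n, (0 : ℝ) < (F n).card := fun n => by exact_mod_cast (hne n).card_pos
  have habs : ∀ (s : ℕ) (x : G), |if Even s then φ x - β else α - φ x| ≤ C := fun s x => by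
    split_ifs
    exacts [hβ x, hα x]
  have hstep : ∀ s, k * (s + 1) < N → ∀ W : Finset G,
      (∀ h ∈ W, ∃ g ∈ D, ∃ i ≤ ν g (2 * k * s), h ∈ rightTranslate (F i) g) →
      ∃ E : Finset G,
        (∀ x ∈ E, ∃ g ∈ D, ∃ i ≤ ν g (2 * k * (s + 1)), x ∈ rightTranslate (F i) g) ∧
        ((W \ E).card : ℝ) ≤ 2 * ε * E.card ∧
        -(2 * C * ε * E.card) ≤ ∑ x ∈ E, if Even s then φ x - β else α - φ x := by
    intro s hs W hW
    choose! g hgD i hi hmem using hW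
    -- Positions strictly between block ends, odd for even `s` and even for odd `s`.
    set pos : ℕ → ℕ := fun t => 2 * k * s + 2 * t + 1 + s % 2 with hposdef
    have hpos_lt : ∀ t < k, pos t ≤ 2 * k * (s + 1) := fun t ht => by
      simp only [hposdef, mul_add, mul_one]; omega
    have hN : 2 * k * (s + 1) < 2 * N := by rw [mul_assoc]; omega
    obtain ⟨E, hE, hWE, hsum⟩ := exists_almostDisjoint_cover hne hε0 (hε.trans (by norm_num))
      hlam0 hlam hF hk hC.le (ψ := fun x => if Even s then φ x - β else α - φ x)
      (fun x => (le_abs_self _).trans (habs s x)) W g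
      (fun h => (Finset.range k).image fun t => ν (g h) (pos t))
      (fun h hh => by
        rw [Finset.card_image_of_injOn, Finset.card_range]
        have hlt : ∀ t t', t < t' → t' < k → ν (g h) (pos t) < ν (g h) (pos t') :=
          fun t t' htt ht' => hmono _ (hgD h hh) _ _ (by simp only [hposdef]; omega)
            ((hpos_lt t' ht').trans_lt hN)
        intro t ht t' ht' htt
        simp only [Finset.coe_range, Set.mem_Iio] at ht ht'
        rcases lt_trichotomy t t' with h1 | h1 | h1
        · exact absurd htt (hlt _ _ h1 ht').ne
        · exact h1
        · exact absurd htt (hlt _ _ h1 ht).ne')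
      (fun h hh => ⟨i h, hmem h hh, fun n hn => by
        obtain ⟨t, ht, rfl⟩ := Finset.mem_image.1 hn
        rw [Finset.mem_range] at ht
        exact (hi h hh).trans_lt (hmono _ (hgD h hh) _ _ (by simp only [hposdef]; omega)
          ((hpos_lt t ht).trans_lt hN))⟩)
      (fun h hh n hn => by
        obtain ⟨t, ht, rfl⟩ := Finset.mem_image.1 hn
        rw [Finset.mem_range] at ht
        have hlt := (hpos_lt t ht).trans_lt hN
        have hp : pos t = 2 * (k * s + t) + 1 + s % 2 := by simp only [hposdef]; ring
        by_cases hse : Even s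
        · have h1 := hodd _ (hgD h hh) _ hlt (by
            rw [hp, Nat.even_iff.1 hse]; exact ⟨_, rfl⟩)
          rw [le_div_iff₀ (hpos _)] at h1
          simp only [hse, if_true, Finset.sum_sub_distrib, Finset.sum_const, nsmul_eq_mul]
          linarith
        · have h1 := heven _ (hgD h hh) _ hlt (by
            rw [hp, Nat.odd_iff.1 (Nat.not_even_iff_odd.1 hse)]; exact ⟨k * s + t + 1, by ring⟩)
          rw [div_le_iff₀ (hpos _)] at h1
          simp only [hse, if_false, Finset.sum_sub_distrib, Finset.sum_const, nsmul_eq_mul]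
          linarith)
    refine ⟨E, fun x hx => ?_, hWE, hsum⟩
    obtain ⟨h, hh, n, hn, hxn⟩ := hE x hx
    obtain ⟨t, ht, rfl⟩ := Finset.mem_image.1 hn
    rw [Finset.mem_range] at ht
    refine ⟨g h, hgD h hh, _, ?_, hxn⟩
    rcases (hpos_lt t ht).eq_or_lt with h1 | h1
    · rw [h1]
    · exact (hmono _ (hgD h hh) _ _ h1 hN).le
  induction s with
  | zero =>
    -- Shifting `D` by `a ∈ F 0` puts its points into translates of scale `0`.
    obtain ⟨a, ha⟩ := hne 0
    obtain ⟨E, hE, hWE, hsum⟩ := hstep 0 hs (a • D) (by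
      intro h hh
      obtain ⟨g, hg, rfl⟩ := Finset.mem_smul_finset.1 hh
      exact ⟨g, hg, 0, Nat.zero_le _, mem_rightTranslate.2 ⟨a, ha, rfl⟩⟩)
    refine ⟨E, hE, ?_, hsum⟩
    have h1 : (D.card : ℝ) ≤ (a • D \ E).card + E.card := by
      rw [← Finset.card_smul_finset a D]
      exact_mod_cast Finset.card_le_card_sdiff_add_card
    have h2 : (0 : ℝ) ≤ E.card := Nat.cast_nonneg _
    rw [pow_zero]
    nlinarith
  | succ s ih =>
    obtain ⟨E₁, hE₁, hD, hsum₁⟩ := ih (by nlinarith)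
    obtain ⟨E₂, hE₂, hWE, hsum₂⟩ := hstep (s + 1) hs E₁ hE₁
    refine ⟨E₂, hE₂, ?_, hsum₂⟩
    have h1 := card_le_mul_card_of_opposite_sums hC hε0.le hε (habs s) hsum₁ (by
      refine hsum₂.trans_eq (Finset.sum_congr rfl fun x _ => ?_)
      rw [← hgap]
      by_cases hse : Even s
      · simp [hse, Nat.even_add_one]
      · simp [hse, Nat.even_add_one]) hWE
    have h0 : 0 ≤ 2 * (1 - 8 * ε) ^ s := mul_nonneg zero_le_two (pow_nonneg (by linarith) _)
    calc (D.card : ℝ) ≤ 2 * (1 - 8 * ε) ^ s * E₁.card := hD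
      _ ≤ 2 * (1 - 8 * ε) ^ s * ((1 - 8 * ε) * E₂.card) := mul_le_mul_of_nonneg_left h1 h0
      _ = _ := by ring

/-! ### Transference to the probability space -/

open Classical in
theorem IsFolnerSequence.exists_card_mul_le {F : ℕ → Finset G} (hF : IsFolnerSequence F)
    (Q : Finset G) : ∃ m, (Q * F m).card ≤ 2 * (F m).card := by
  obtain ⟨hne, hfol⟩ := hF
  have h1 : ∀ q ∈ Q, ∀ᶠ m in atTop, Q.card * (q • F m \ F m).card ≤ (F m).card := by
    intro q hq
    let _ : MeasurableSpace G := ⊤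
    have hQ : (0 : ℝ≥0∞) < (Q.card : ℝ≥0∞)⁻¹ := by simp
    filter_upwards [(hfol.tendsto_meas_smul_symmDiff q).eventually_lt_const hQ] with m hm
    have hF0 : ((F m).card : ℝ≥0∞) ≠ 0 := by simpa using (hne m).ne_empty
    have hcoe : (q • (F m : Set G)) = ((q • F m : Finset G) : Set G) := by simp
    have hsd : Measure.count ((q • F m \ F m : Finset G) : Set G) ≤
        Measure.count (symmDiff (q • (F m : Set G)) (F m)) := by
      refine measure_mono ?_
      rw [hcoe, Finset.coe_sdiff]
      exact le_sup_left
    rw [Measure.count_apply_finset] at hsd hm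
    have hQ0 : (Q.card : ℝ≥0∞) ≠ 0 := by simpa using Finset.ne_empty_of_mem hq
    have h2 := (ENNReal.div_le_iff_le_mul (Or.inl hF0) (Or.inl (ENNReal.natCast_ne_top _))).1 hm.le
    have h3 : (Q.card : ℝ≥0∞) * (q • F m \ F m).card ≤ (F m).card := by
      calc (Q.card : ℝ≥0∞) * (q • F m \ F m).card
          ≤ Q.card * ((Q.card : ℝ≥0∞)⁻¹ * (F m).card) := by gcongr; exact hsd.trans h2
        _ = (F m).card := by
          rw [← mul_assoc, ENNReal.mul_inv_cancel hQ0 (ENNReal.natCast_ne_top _), one_mul]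
    exact_mod_cast h3
  obtain ⟨m, hm⟩ := ((Filter.eventually_all_finset Q).2 h1).exists
  refine ⟨m, ?_⟩
  rcases Q.eq_empty_or_nonempty with rfl | hQ
  · simp
  have hsub : Q * F m ⊆ F m ∪ Q.biUnion fun q => q • F m \ F m := by
    intro x hx
    obtain ⟨q, hq, y, hy, rfl⟩ := Finset.mem_mul.1 hx
    by_cases h : q * y ∈ F m
    · exact Finset.mem_union_left _ h
    · exact Finset.mem_union_right _ (Finset.mem_biUnion.2 ⟨q, hq,
        Finset.mem_sdiff.2 ⟨Finset.mem_smul_finset.2 ⟨y, hy, rfl⟩, h⟩⟩)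
  have h2 : Q.card * ∑ q ∈ Q, (q • F m \ F m).card ≤ Q.card * (F m).card := by
    rw [Finset.mul_sum, ← smul_eq_mul Q.card]
    exact Finset.sum_le_card_nsmul _ _ _ hm
  have h3 := (Finset.card_le_card hsub).trans ((Finset.card_union_le _ _).trans
    (Nat.add_le_add_left Finset.card_biUnion_le _))
  have h4 := Nat.le_of_mul_le_mul_left h2 hQ.card_pos
  omega

variable {X : Type*} [MulAction G X]

/-- The points whose averages fluctuate at least `N` times across `(α, β)` at indices that are at
most `R`. Only finitely many sets `F n` matter for it. -/
def boundedFluctuationSet (F : ℕ → Finset G) (f : X → ℝ) (α β : ℝ) (N R : ℕ) : Set X :=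
  {x | ∃ n : Fin (2 * N) → ℕ, StrictMono n ∧ (∀ i, n i ≤ R) ∧
    ∀ i, (Even i.val → ergodicAverage (F (n i)) f x ≤ α) ∧
      (Odd i.val → β ≤ ergodicAverage (F (n i)) f x)}

theorem monotone_boundedFluctuationSet (F : ℕ → Finset G) (f : X → ℝ) (α β : ℝ) (N : ℕ) :
    Monotone (boundedFluctuationSet F f α β N) := by
  rintro R R' hR x ⟨n, hn, hnR, h⟩
  exact ⟨n, hn, fun i => (hnR i).trans hR, h⟩

theorem iUnion_boundedFluctuationSet (F : ℕ → Finset G) (f : X → ℝ) (α β : ℝ) (N : ℕ) :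
    ⋃ R, boundedFluctuationSet F f α β N R = fluctuationSet F f α β N := by
  ext x
  simp only [Set.mem_iUnion]
  constructor
  · rintro ⟨R, n, hn, -, h⟩
    exact ⟨n, hn, h⟩
  · rintro ⟨n, hn, h⟩
    exact ⟨Finset.univ.sup n, n, hn, fun i => Finset.le_sup (Finset.mem_univ i), h⟩

variable [MeasurableSpace X]

theorem measurable_ergodicAverage (hsm : ∀ g : G, Measurable fun x : X => g • x) (E : Finset G)
    {f : X → ℝ} (hf : Measurable f) : Measurable (ergodicAverage E f) := by
  unfold ergodicAverage
  exact (Finset.measurable_fun_sum _ fun g _ => hf.comp (hsm g)).div_const _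

theorem measurableSet_boundedFluctuationSet (hsm : ∀ g : G, Measurable fun x : X => g • x)
    (F : ℕ → Finset G) {f : X → ℝ} (hf : Measurable f) (α β : ℝ) (N R : ℕ) :
    MeasurableSet (boundedFluctuationSet F f α β N R) := by
  have hA : ∀ n, Measurable (ergodicAverage (F n) f) := fun n =>
    measurable_ergodicAverage hsm (F n) hf
  have hU : boundedFluctuationSet F f α β N R =
      ⋃ n ∈ {n : Fin (2 * N) → ℕ | StrictMono n ∧ ∀ i, n i ≤ R}, ⋂ i,
        {x | Even i.val → ergodicAverage (F (n i)) f x ≤ α} ∩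
          {x | Odd i.val → β ≤ ergodicAverage (F (n i)) f x} := by
    ext x
    simp [boundedFluctuationSet, and_assoc]
  rw [hU]
  refine MeasurableSet.biUnion (Set.to_countable _) fun n _ =>
    MeasurableSet.iInter fun i => MeasurableSet.inter ?_ ?_
  · by_cases h : Even i.val
    · simpa [h] using measurableSet_le (hA _) measurable_const
    · simp [h]
  · by_cases h : Odd i.val
    · simpa [h] using measurableSet_le measurable_const (hA _)
    · simp [h]

open Classical in
/-- If every orbit segment `B • x` spends at most a proportion `c` of its time in `S`, then
`μ S ≤ c`. -/
theorem measure_le_of_card_orbit_le {μ : Measure X} [IsProbabilityMeasure μ]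
    (hT : ∀ g : G, MeasurePreserving (fun x : X => g • x) μ μ) {S : Set X} (hS : MeasurableSet S)
    {B : Finset G} (hB : B.Nonempty) {c : ℝ} (hc : 0 ≤ c)
    (h : ∀ x, ({b ∈ B | b • x ∈ S}.card : ℝ) ≤ c * B.card) : μ S ≤ ENNReal.ofReal c := by
  have h1 : ∫⁻ x, ∑ b ∈ B, S.indicator 1 (b • x) ∂μ = B.card * μ S := by
    rw [lintegral_finsetSum]
    · have : ∀ b ∈ B, ∫⁻ x, S.indicator (1 : X → ℝ≥0∞) (b • x) ∂μ = μ S := fun b _ => by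
        rw [(hT b).lintegral_comp (measurable_one.indicator hS), lintegral_indicator_one hS]
      rw [Finset.sum_congr rfl this, Finset.sum_const, nsmul_eq_mul]
    · exact fun b _ => (measurable_one.indicator hS).comp (hT b).measurable
  have h2 : ∫⁻ x, ∑ b ∈ B, S.indicator 1 (b • x) ∂μ ≤ ∫⁻ _, ENNReal.ofReal c * B.card ∂μ := by
    refine lintegral_mono fun x => ?_
    have : ∑ b ∈ B, S.indicator (1 : X → ℝ≥0∞) (b • x) = ({b ∈ B | b • x ∈ S}.card : ℝ≥0∞) := by
      rw [Finset.card_filter, Nat.cast_sum]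
      refine Finset.sum_congr rfl fun b _ => ?_
      by_cases hb : b • x ∈ S <;> simp [hb]
    rw [this, ← ENNReal.ofReal_natCast, ← ENNReal.ofReal_natCast, ← ENNReal.ofReal_mul hc]
    exact ENNReal.ofReal_le_ofReal (h x)
  rw [h1, lintegral_const, measure_univ, mul_one, mul_comm (ENNReal.ofReal c)] at h2
  exact (ENNReal.mul_le_mul_iff_right (by simpa using hB.ne_empty) (ENNReal.natCast_ne_top _)).1 h2

open Classical in
theorem measure_boundedFluctuationSet_le {F : ℕ → Finset G} (hFol : IsFolnerSequence F)
    {lam ε C α β : ℝ} (hε0 : 0 < ε) (hε : ε ≤ 1 / 16) (hlam0 : 0 ≤ lam) (hlam : lam ≤ ε / 2)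
    (hF : IsBiTempered (1 + lam) F) {k : ℕ} (hk : 2 / ε ^ 2 ≤ k) (hC : 0 < C)
    (hgap : β - α = 16 * ε * C) {μ : Measure X} [IsProbabilityMeasure μ]
    (hT : ∀ g : G, MeasurePreserving (fun x : X => g • x) μ μ) {f : X → ℝ} (hf : Measurable f)
    (hα : ∀ x, |α - f x| ≤ C) (hβ : ∀ x, |f x - β| ≤ C) {N s : ℕ} (hs : k * (s + 1) < N) (R : ℕ) :
    μ (boundedFluctuationSet F f α β N R) ≤ ENNReal.ofReal (4 * (1 - 8 * ε) ^ s) := by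
  set Q := (Finset.range (R + 1)).biUnion F with hQ
  obtain ⟨m, hm⟩ := hFol.exists_card_mul_le Q
  have hpow : 0 ≤ (1 - 8 * ε) ^ s := pow_nonneg (by linarith) _
  refine measure_le_of_card_orbit_le hT
    (measurableSet_boundedFluctuationSet (fun g => (hT g).measurable) F hf α β N R)
    (hFol.1 m) (by positivity) fun x => ?_
  set D := {b ∈ F m | b • x ∈ boundedFluctuationSet F f α β N R} with hD
  have hmem : ∀ g ∈ D, g • x ∈ boundedFluctuationSet F f α β N R := fun g hg =>
    (Finset.mem_filter.1 hg).2
  choose! n hmono hR hfl using hmem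
  have hN : 0 < 2 * N := by omega
  set ν : G → ℕ → ℕ := fun g j => if h : j < 2 * N then n g ⟨j, h⟩ else 0 with hν
  have hνe : ∀ g j (h : j < 2 * N), ν g j = n g ⟨j, h⟩ := fun g j h => dif_pos h
  have havg : ∀ g i, ergodicAverage (F i) f (g • x) =
      (∑ y ∈ F i, f ((y * g) • x)) / (F i).card := fun g i => by
    simp [ergodicAverage, mul_smul]
  obtain ⟨E, hE, hDE, -⟩ := card_le_of_fluctuations hFol.1 hε0 hε hlam0 hlam hF hk hC hgap
    (φ := fun g => f (g • x)) (fun g => hα _) (fun g => hβ _) (D := D) (N := N) (ν := ν)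
    (fun g hg i j hij hj => by
      rw [hνe g i (hij.trans hj), hνe g j hj]
      exact hmono g hg (by simpa using hij))
    (fun g hg j hj hje => by
      rw [hνe g j hj, ← havg]
      exact (hfl g hg ⟨j, hj⟩).1 hje)
    (fun g hg j hj hjo => by
      rw [hνe g j hj, ← havg]
      exact (hfl g hg ⟨j, hj⟩).2 hjo) s hs
  have hsub : E ⊆ Q * F m := by
    intro z hz
    obtain ⟨g, hg, i, hi, hzi⟩ := hE z hz
    obtain ⟨y, hy, rfl⟩ := mem_rightTranslate.1 hzi
    rw [hνe g _ (by rw [mul_assoc]; omega)] at hi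
    have := hi.trans (hR g hg _)
    exact Finset.mul_mem_mul (Finset.mem_biUnion.2 ⟨i, by simpa [Nat.lt_succ_iff] using this, hy⟩)
      (Finset.mem_filter.1 hg).1
  have h1 : (E.card : ℝ) ≤ 2 * (F m).card := by
    exact_mod_cast (Finset.card_le_card hsub).trans hm
  calc (D.card : ℝ) ≤ 2 * (1 - 8 * ε) ^ s * E.card := hDE
    _ ≤ 2 * (1 - 8 * ε) ^ s * (2 * (F m).card) := by gcongr
    _ = _ := by ring

theorem exists_measurable_bounded_ae_eq {μ : Measure X} {f : X → ℝ} {S : ℝ} (hS : 0 ≤ S)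
    (hf : MemLp f ∞ μ) (hfS : eLpNorm f ∞ μ ≤ ENNReal.ofReal S) :
    ∃ f' : X → ℝ, Measurable f' ∧ (∀ x, |f' x| ≤ S) ∧ f =ᵐ[μ] f' := by
  have hb : ∀ᵐ x ∂μ, |f x| ≤ S := by
    rw [eLpNorm_exponent_top] at hfS
    filter_upwards [ae_le_eLpNormEssSup (f := f) (μ := μ)] with x hx
    have := hx.trans hfS
    rw [← ofReal_norm, ENNReal.ofReal_le_ofReal_iff hS] at this
    simpa using this
  have hm := hf.1.aemeasurable
  refine ⟨fun x => max (-S) (min S (hm.mk f x)),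
    measurable_const.max (measurable_const.min hm.measurable_mk), fun x => ?_, ?_⟩
  · exact abs_le.2 ⟨le_max_left _ _, max_le (by linarith) (min_le_left _ _)⟩
  · filter_upwards [hm.ae_eq_mk, hb] with x hx hxb
    rw [← hx, min_eq_right (abs_le.1 hxb).2, max_eq_right (abs_le.1 hxb).1]

theorem fluctuationSet_ae_eq [Countable G] {μ : Measure X}
    (hT : ∀ g : G, MeasurePreserving (fun x : X => g • x) μ μ) (F : ℕ → Finset G) {f f' : X → ℝ}
    (hff : f =ᵐ[μ] f') (α β : ℝ) (N : ℕ) :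
    fluctuationSet F f α β N =ᵐ[μ] fluctuationSet F f' α β N := by
  have h : ∀ᵐ x ∂μ, ∀ g : G, f (g • x) = f' (g • x) :=
    ae_all_iff.2 fun g => (hT g).quasiMeasurePreserving.ae hff
  filter_upwards [h] with x hx
  have : ∀ n, ergodicAverage (F n) f x = ergodicAverage (F n) f' x := fun n => by
    simp [ergodicAverage, hx]
  change (x ∈ fluctuationSet F f α β N) = (x ∈ fluctuationSet F f' α β N)
  simp [fluctuationSet, this]

end

/-! ### The exponential bound -/

/-- The constant `c₁` is a function of the group and the sequence alone; `lam` and `c₀` are chosen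
after `α`, `β`, `S` and before the group, the sequence, the action and the function. -/
theorem theorem1p2 :
    ∃ c₁ : (G : Type u) → [Group G] → (ℕ → Finset G) → ℝ,
      (∀ (G : Type u) [Group G] (F : ℕ → Finset G), 0 < c₁ G F) ∧
      ∀ α β S : ℝ, α < β → 0 < S →
        ∃ lam c₀ : ℝ, 0 < lam ∧ 0 < c₀ ∧ c₀ < 1 ∧
          ∀ (G : Type u) [Group G] [Countable G] (F : ℕ → Finset G),
            IsFolnerSequence F → IsBiTempered (1 + lam) F →
            ∀ (X : Type v) [MeasurableSpace X] (μ : Measure X) [IsProbabilityMeasure μ]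
              [MulAction G X],
              (∀ g : G, MeasurePreserving (fun x : X => g • x) μ μ) →
              ∀ f : X → ℝ, MemLp f ∞ μ → eLpNorm f ∞ μ ≤ ENNReal.ofReal S →
                ∀ N : ℕ, μ.real (fluctuationSet F f α β N) ≤ c₁ G F * c₀ ^ N := by
  refine ⟨fun _ _ _ => 16, fun _ _ _ => by norm_num, fun α β S hαβ hS => ?_⟩
  -- `C` bounds `|f - α|` and `|f - β|`; `16 * ε` is the gap `β - α` in units of `C`.
  set C := S + |α| + |β| with hCdef
  have hC : 0 < C := by positivity
  set ε := (β - α) / (16 * C) with hεdef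
  have hε0 : 0 < ε := div_pos (sub_pos.2 hαβ) (by positivity)
  have hgap : β - α = 16 * ε * C := by rw [hεdef]; field_simp
  have hε : ε ≤ 1 / 16 := by
    rw [hεdef, div_le_div_iff₀ (by positivity) (by norm_num)]
    linarith [neg_abs_le α, le_abs_self β]
  obtain ⟨k, hk⟩ := exists_nat_ge (2 / ε ^ 2)
  have hk0 : k ≠ 0 := by
    rintro rfl
    rw [Nat.cast_zero] at hk
    exact absurd hk (not_le.2 (by positivity))
  set r := 1 - 8 * ε with hr
  have hr0 : 0 < r := by linarith
  have hr2 : 1 / 2 ≤ r := by linarith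
  set c₀ : ℝ := r ^ ((k : ℝ)⁻¹) with hc₀
  have hc₀pos : 0 < c₀ := Real.rpow_pos_of_pos hr0 _
  have hc₀lt : c₀ < 1 := Real.rpow_lt_one hr0.le (by linarith) (by positivity)
  have hc₀k : c₀ ^ k = r := Real.rpow_inv_natCast_pow hr0.le hk0
  refine ⟨ε / 2, c₀, by positivity, hc₀pos, hc₀lt, ?_⟩
  intro G _ _ F hFol hF X _ μ _ _ hT f hf hfS N
  -- The first block of `k` fluctuations gives no growth, and up to `k` are left over at the end.
  -- As `r ≥ 1 / 2`, the two factors `r = c₀ ^ k` lost in this way fit into the constant `16`.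
  rcases le_or_gt N k with hN | hN
  · calc μ.real (fluctuationSet F f α β N) ≤ 1 := measureReal_le_one
      _ ≤ 16 * c₀ ^ k := by rw [hc₀k]; linarith
      _ ≤ 16 * c₀ ^ N := by
        gcongr 16 * ?_
        exact pow_le_pow_of_le_one hc₀pos.le hc₀lt.le hN
  obtain ⟨s, hs, hs'⟩ : ∃ s, k * (s + 1) < N ∧ N ≤ k * (s + 2) := by
    have h1 : 0 < (N - 1) / k := Nat.div_pos (by omega) (Nat.pos_of_ne_zero hk0)
    refine ⟨(N - 1) / k - 1, ?_, ?_⟩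
    · have := Nat.mul_div_le (N - 1) k
      rw [Nat.sub_add_cancel h1]
      omega
    · have := Nat.lt_mul_div_succ (N - 1) (Nat.pos_of_ne_zero hk0)
      rw [show (N - 1) / k - 1 + 2 = (N - 1) / k + 1 by omega]
      omega
  obtain ⟨f', hf'm, hf'S, hff'⟩ := exists_measurable_bounded_ae_eq hS.le hf hfS
  have hα : ∀ x, |α - f' x| ≤ C := fun x => (abs_sub _ _).trans (by
    linarith [hf'S x, abs_nonneg β])
  have hβ : ∀ x, |f' x - β| ≤ C := fun x => (abs_sub _ _).trans (by
    linarith [hf'S x, abs_nonneg α])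
  have hmeas : μ (fluctuationSet F f α β N) ≤ ENNReal.ofReal (4 * r ^ s) := by
    rw [measure_congr (fluctuationSet_ae_eq hT F hff' α β N), ← iUnion_boundedFluctuationSet,
      (monotone_boundedFluctuationSet F f' α β N).measure_iUnion]
    exact iSup_le fun R => measure_boundedFluctuationSet_le hFol hε0 hε (by positivity) le_rfl hF
      hk hC hgap hT hf'm hα hβ hs R
  have hrs : 0 < r ^ s := pow_pos hr0 s
  calc μ.real (fluctuationSet F f α β N) ≤ 4 * r ^ s :=
        ENNReal.toReal_le_of_le_ofReal (by positivity) hmeas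
    _ ≤ 16 * r ^ (s + 2) := by rw [pow_add]; nlinarith [mul_nonneg hrs.le (sub_nonneg.2 hr2)]
    _ = 16 * c₀ ^ (k * (s + 2)) := by rw [pow_mul, hc₀k]
    _ ≤ 16 * c₀ ^ N := by
      gcongr 16 * ?_
      exact pow_le_pow_of_le_one hc₀pos.le hc₀lt.le hs'
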